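/- All spaces are assumed to be Tychonoff (completely regular and Hausdorff). A space $X$ is *Menger* if for every sequence $(\mathcal U_n)_{n\in\mathbb N}$ of open covers of $X$ there are finite $\mathcal V_n\subseteq\mathcal U_n$ such that $\bigcup_n\bigcup\mathcal V_n=X$; it is *locally Menger* if for every $x\in X$ there are an open set $U$ and a Menger subspace $Y$ of $X$ with $x\in U\subseteq Y$. A *compactification* of $X$ is a compact Hausdorff space $bX$ containing $X$ as a dense subspace, and the subspace $bX\setminus X$ is then called a *remainder* of $X$. A space $X$ is a *$p$-space* if in some (equivalently, in every) compactification $bX$ of $X$ there is a sequence $(\mathcal U_n)_{n\in\mathbb N}$ of families of open subsets of $bX$ such that $x\in\bigcap_{n}\bigcup\{U\in\mathcal U_n : x\in U\}\subseteq X$ for every $x\in X$. A *Lindelöf $\Sigma$-space* is a continuous image of a Lindelöf $p$-space. A space $Y$ is *homogeneous* if for all $x,y\in Y$ there is a homeomorphism $f:Y\to Y$ with $f(x)=y$. A space is *nowhere locally compact* if none of its points has a compact neighbourhood. **Theorem.** Let $X$ be a locally Menger $p$-space that has a homogeneous remainder in some compactification. Then $X=L\cup Z$, where $L$ is a closed subspace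 of $X$ that is a Lindelöf $\Sigma$-space, and $Z$ is an open locally compact subspace of $X$. If, in addition, $X$ is nowhere locally compact, then $X$ itself is a Lindelöf $\Sigma$-space. -/

import Mathlib

open Set Topology

universe u

/-- A Menger space: from every sequence of open covers one can select finite subfamilies that
together cover the space. -/
def IsMengerSpace (X : Type u) [TopologicalSpace X] : Prop :=
  ∀ 𝒰 : ℕ → Set (Set X),
    (∀ n, (∀ U ∈ 𝒰 n, IsOpen U) ∧ ⋃₀ 𝒰 n = univ) →
    ∃ 𝒱 : ℕ → Set (Set X),
      (∀ n, 𝒱 n ⊆ 𝒰 n ∧ (𝒱 n).Finite) ∧ ⋃ n, ⋃₀ 𝒱 n = univ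

/-- A locally Menger space: every point lies in an open set contained in a Menger subspace. -/
def IsLocallyMengerSpace (X : Type u) [TopologicalSpace X] : Prop :=
  ∀ x : X, ∃ U Y : Set X, IsOpen U ∧ IsMengerSpace Y ∧ x ∈ U ∧ U ⊆ Y

/-- `e : X → B` is a (Hausdorff) compactification of `X`. -/
structure IsCompactification {X B : Type u} [TopologicalSpace X] [TopologicalSpace B]
    (e : X → B) : Prop where
  compact : CompactSpace B
  t2 : T2Space B
  isDenseEmbedding : IsDenseEmbedding e

/-- The remainder of `X` in the compactification `e : X → B`, as a subset of `B`. -/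
def remainder {X B : Type u} (e : X → B) : Set B := (range e)ᶜ

/-- A homogeneous space: the homeomorphism group acts transitively. -/
def IsHomogeneousSpace (X : Type u) [TopologicalSpace X] : Prop :=
  ∀ x y : X, ∃ f : X ≃ₜ X, f x = y

/-- `X` has a homogeneous remainder in some compactification. -/
def HasHomogeneousRemainder (X : Type u) [TopologicalSpace X] : Prop :=
  ∃ (B : Type u) (_ : TopologicalSpace B) (e : X → B),
    IsCompactification e ∧ IsHomogeneousSpace (remainder e)

/-- A `p`-space (in the sense of Arhangel'skii): in some compactification `e : X → B` there is a
sequence `𝒰` of families of open subsets of `B` such that, for every `x` in `X`, the intersection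
of the stars of `x` with respect to the `𝒰 n` contains `x` and is contained in `X`. -/
def IsPSpace (X : Type u) [TopologicalSpace X] : Prop :=
  ∃ (B : Type u) (_ : TopologicalSpace B) (e : X → B),
    IsCompactification e ∧
    ∃ 𝒰 : ℕ → Set (Set B),
      (∀ n, ∀ U ∈ 𝒰 n, IsOpen U) ∧
      ∀ x : X,
        e x ∈ (⋂ n, ⋃₀ {U | U ∈ 𝒰 n ∧ e x ∈ U}) ∧
        (⋂ n, ⋃₀ {U | U ∈ 𝒰 n ∧ e x ∈ U}) ⊆ range e

/-- A Lindelöf `Σ`-space: a continuous image of a Lindelöf `p`-space. -/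
def IsLindelofSigmaSpace (X : Type u) [TopologicalSpace X] : Prop :=
  ∃ (P : Type u) (_ : TopologicalSpace P) (f : P → X),
    LindelofSpace P ∧ IsPSpace P ∧ Continuous f ∧ Function.Surjective f

/-- No point has a compact neighbourhood. -/
def IsNowhereLocallyCompact (X : Type u) [TopologicalSpace X] : Prop :=
  ∀ x : X, ¬ ∃ K ∈ 𝓝 x, IsCompact K

open Filter

section Lindelof

variable {X B B' : Type*} [TopologicalSpace X] [TopologicalSpace B] [TopologicalSpace B']

theorem IsProperMap.isLindelof_preimage {f : B → B'} (hf : IsProperMap f) {s : Set B'}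
    (hs : IsLindelof s) : IsLindelof (f ⁻¹' s) := by
  intro l _ _ hl
  obtain ⟨y, hy, hyl⟩ := hs (f := map f l) (by rwa [le_principal_iff, mem_map, ← le_principal_iff])
  obtain ⟨x, rfl, hx⟩ := hf.clusterPt_of_mapClusterPt hyl
  exact ⟨x, hy, hx⟩

/-- A point of the closure of the joint graph of `e` and `e'` whose second coordinate comes
from `x` has first coordinate `e x`. -/
theorem fst_eq_of_mem_closure_range_prodMk [T2Space B] {e : X → B} {e' : X → B'}
    (he : Continuous e) (he' : IsInducing e') {b : B} {x : X}
    (h : (b, e' x) ∈ closure (range fun x => (e x, e' x))) : b = e x := by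
  rw [mem_closure_iff_ultrafilter] at h
  obtain ⟨u, hu, hle⟩ := h
  have hne : (comap (fun x => (e x, e' x)) (u : Filter (B × B'))).NeBot :=
    comap_neBot_iff.2 fun t ht => by
      obtain ⟨_, h1, y, rfl⟩ := u.neBot.nonempty_of_mem (inter_mem ht hu)
      exact ⟨y, h1⟩
  have ht : Tendsto (fun x => (e x, e' x)) (comap (fun x => (e x, e' x)) (u : Filter (B × B')))
      (𝓝 (b, e' x)) := tendsto_comap.mono_right hle
  have h1 : Tendsto e (comap (fun x => (e x, e' x)) (u : Filter (B × B'))) (𝓝 b) :=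
    (continuous_fst.tendsto _).comp ht
  have h2 : Tendsto e' (comap (fun x => (e x, e' x)) (u : Filter (B × B'))) (𝓝 (e' x)) :=
    (continuous_snd.tendsto _).comp ht
  have h3 : Tendsto id (comap (fun x => (e x, e' x)) (u : Filter (B × B'))) (𝓝 x) :=
    he'.tendsto_nhds_iff.2 h2
  exact tendsto_nhds_unique h1 ((he.tendsto x).comp h3)

/-- Whether the remainder of `X` is Lindelöf does not depend on the embedding into a compact
Hausdorff space. -/
theorem isLindelof_closure_range_diff_range [CompactSpace B] [T2Space B] [CompactSpace B']
    [T2Space B'] {e : X → B} {e' : X → B'} (he : IsInducing e) (he' : IsInducing e')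
    (h : IsLindelof (closure (range e') \ range e')) :
    IsLindelof (closure (range e) \ range e) := by
  set D : Set (B × B') := closure (range fun x => (e x, e' x)) with hD
  have hsnd : D ⊆ Prod.snd ⁻¹' closure (range e') :=
    closure_minimal (by rintro _ ⟨x, rfl⟩; exact subset_closure ⟨x, rfl⟩)
      (isClosed_closure.preimage continuous_snd)
  have hfst : D ⊆ Prod.fst ⁻¹' closure (range e) :=
    closure_minimal (by rintro _ ⟨x, rfl⟩; exact subset_closure ⟨x, rfl⟩)
      (isClosed_closure.preimage continuous_fst)
  have hswap : ∀ {b : B} {b' : B'}, (b, b') ∈ D →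
      (b', b) ∈ closure (range fun x => (e' x, e x)) := by
    intro b b' hb
    refine map_mem_closure (f := Prod.swap) continuous_swap hb ?_
    rintro _ ⟨x, rfl⟩
    exact ⟨x, rfl⟩
  have key : closure (range e) \ range e =
      Prod.fst '' (Prod.snd ⁻¹' (closure (range e') \ range e') ∩ D) := by
    ext b
    constructor
    · rintro ⟨hb, hbe⟩
      have hcl : IsClosed (Prod.fst '' D) :=
        isClosedMap_fst_of_compactSpace _ isClosed_closure
      have hsub : closure (range e) ⊆ Prod.fst '' D :=
        closure_minimal (by rintro _ ⟨x, rfl⟩; exact ⟨_, subset_closure ⟨x, rfl⟩, rfl⟩) hcl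
      obtain ⟨⟨_, b'⟩, hbD, rfl⟩ := hsub hb
      refine ⟨_, ⟨⟨hsnd hbD, ?_⟩, hbD⟩, rfl⟩
      rintro ⟨x, rfl⟩
      exact hbe ⟨x, (fst_eq_of_mem_closure_range_prodMk he.continuous he' hbD).symm⟩
    · rintro ⟨⟨_, b'⟩, ⟨⟨-, hb'⟩, hbD⟩, rfl⟩
      refine ⟨hfst hbD, ?_⟩
      rintro ⟨x, rfl⟩
      exact hb' ⟨x, (fst_eq_of_mem_closure_range_prodMk he'.continuous he (hswap hbD)).symm⟩
  rw [key]
  exact ((isProperMap_snd_of_compactSpace.isLindelof_preimage h).inter_right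
    isClosed_closure).image continuous_fst

/-- If a subset `A` of a compact Hausdorff space has a feathering, then its complement
is Lindelöf. -/
theorem isLindelof_compl_of_feathering [CompactSpace B] [T2Space B] {A : Set B}
    {𝒰 : ℕ → Set (Set B)} (ho : ∀ n, ∀ U ∈ 𝒰 n, IsOpen U)
    (hcov : ∀ x ∈ A, ∀ n, ∃ U ∈ 𝒰 n, x ∈ U)
    (hstar : ∀ x ∈ A, ∀ z, (∀ n, ∃ U ∈ 𝒰 n, x ∈ U ∧ z ∈ U) → z ∈ A) :
    IsLindelof Aᶜ := by
  intro f _ _ hf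
  by_contra! hcl
  set C : Set B := {x | ClusterPt x f}
  have hCA : C ⊆ A := fun x hx => by
    by_contra hxA
    exact hcl x hxA hx
  have hC : IsCompact C := isClosed_setOfPred_clusterPt.isCompact
  have hmem : ∀ O : Set B, IsOpen O → C ⊆ O → O ∈ f := fun O hO hCO =>
    isLindelof_univ.adherence_nhdset (by simp) hO fun x _ hx => hCO hx
  have hV : ∀ n, ∀ x ∈ C, ∃ V : Set B, IsOpen V ∧ x ∈ V ∧ ∃ U ∈ 𝒰 n, closure V ⊆ U := by
    intro n x hx
    obtain ⟨U, hU, hxU⟩ := hcov x (hCA hx) n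
    obtain ⟨K, hK, hKc, hKU⟩ := exists_mem_nhds_isClosed_subset ((ho n U hU).mem_nhds hxU)
    exact ⟨interior K, isOpen_interior, mem_interior_iff_mem_nhds.2 hK, U, hU,
      (closure_minimal interior_subset hKc).trans hKU⟩
  choose! V hVo hxV U hU hVU using hV
  have hfin : ∀ n, ∃ t : Finset B, (∀ x ∈ t, x ∈ C) ∧ C ⊆ ⋃ x ∈ t, V n x := fun n =>
    hC.elim_nhds_subcover (V n) fun x hx => (hVo n x hx).mem_nhds (hxV n x hx)
  choose t htC hCt using hfin
  have h1 : ∀ᶠ z in f, ∀ n, z ∈ ⋃ x ∈ t n, V n x :=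
    eventually_countable_forall.2 fun n =>
      hmem _ (isOpen_biUnion fun x hx => hVo n x (htC n x hx)) (hCt n)
  have h2 : ∀ᶠ z in f, ∀ s : Finset (Σ n, t n),
      C ∩ (⋂ i ∈ s, closure (V i.1 i.2)) = ∅ → z ∉ ⋂ i ∈ s, closure (V i.1 i.2) := by
    refine eventually_countable_forall.2 fun s => eventually_imp_distrib_left.2 fun hs => ?_
    exact hmem (⋂ i ∈ s, closure (V i.1 i.2))ᶜ
      (isClosed_biInter fun _ _ => isClosed_closure).isOpen_compl
      (disjoint_iff_inter_eq_empty.2 hs).subset_compl_right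
  obtain ⟨z, hz1, hz2, hzA⟩ := (h1.and (h2.and (le_principal_iff.1 hf))).exists
  simp only [mem_iUnion, exists_prop] at hz1
  choose i hit hzi using hz1
  obtain ⟨x, hxC, hx⟩ : (C ∩ ⋂ n, closure (V n (i n))).Nonempty := by
    refine hC.inter_iInter_nonempty _ (fun _ => isClosed_closure) fun u => ?_
    rw [nonempty_iff_ne_empty]
    intro hu
    classical
    refine hz2 (u.image fun n => ⟨n, i n, hit n⟩) ?_ ?_
    · simpa using hu
    · simpa using fun n _ => subset_closure (hzi n)
  refine hzA (hstar x (hCA hxC) z fun n => ⟨U n (i n), hU _ _ (htC n _ (hit n)), ?_, ?_⟩)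
  · exact hVU _ _ (htC n _ (hit n)) (mem_iInter.1 hx n)
  · exact hVU _ _ (htC n _ (hit n)) (subset_closure (hzi n))

/-- If `Y` is a Lindelöf homogeneous subspace of a compact Hausdorff space whose complement is
locally Lindelöf, then the remainder of `Y` is Lindelöf. -/
theorem isLindelof_closure_diff_of_homogeneous [CompactSpace B] [T2Space B] {Y : Set B}
    (hY : IsLindelof Y) (hhom : ∀ x y : Y, ∃ f : Y ≃ₜ Y, f x = y)
    (hloc : ∀ a ∉ Y, ∃ W : Set B, IsOpen W ∧ a ∈ W ∧ IsLindelof (closure W \ Y)) :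
    IsLindelof (closure Y \ Y) := by
  rcases (closure Y \ Y).eq_empty_or_nonempty with h0 | ⟨a, haY, ha⟩
  · rw [h0]
    exact isLindelof_empty
  obtain ⟨W, hWo, haW, hW⟩ := hloc a ha
  obtain ⟨y₀, hy₀W, hy₀⟩ := mem_closure_iff.1 haY W hWo haW
  have hrange : ∀ {G : Set Y}, IsClosed G → ∀ b ∈ Y,
      b ∈ closure (range fun y : G => ((y : Y) : B)) → b ∈ range fun y : G => ((y : Y) : B) := by
    intro G hG b hb hbG
    have hr : (range fun y : G => ((y : Y) : B)) = Subtype.val '' G := by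
      ext; simp
    rw [hr] at hbG ⊢
    refine ⟨⟨b, hb⟩, ?_, rfl⟩
    rwa [← hG.closure_eq, closure_subtype]
  have hrem : ∀ {G : Set Y}, IsClosed G →
      closure (range fun y : G => ((y : Y) : B)) \ range (fun y : G => ((y : Y) : B)) =
        closure (range fun y : G => ((y : Y) : B)) \ Y := by
    intro G hG
    ext b
    refine and_congr_right fun hb => not_congr ⟨?_, fun h => hrange hG b h hb⟩
    rintro ⟨y, rfl⟩
    exact y.1.2
  set G₀ : Set Y := Subtype.val ⁻¹' closure W
  have hG₀c : IsClosed G₀ := isClosed_closure.preimage continuous_subtype_val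
  have hG₀n : G₀ ∈ 𝓝 (⟨y₀, hy₀⟩ : Y) :=
    mem_of_superset ((hWo.preimage continuous_subtype_val).mem_nhds hy₀W)
      (preimage_mono subset_closure)
  have hG₀ : IsLindelof (closure (range fun y : G₀ => ((y : Y) : B)) \
      range fun y : G₀ => ((y : Y) : B)) := by
    have hsub : closure (range fun y : G₀ => ((y : Y) : B)) ⊆ closure W :=
      closure_minimal (by rintro _ ⟨y, rfl⟩; exact y.2) isClosed_closure
    rw [hrem hG₀c]
    convert hW.inter_right (isClosed_closure (s := range fun y : G₀ => ((y : Y) : B))) using 1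
    ext b
    exact ⟨fun h => ⟨⟨hsub h.1, h.2⟩, h.1⟩, fun h => ⟨h.2, h.1.2⟩⟩
  have hpt : ∀ y ∈ Y, ∃ O F : Set B, IsOpen O ∧ y ∈ O ∧ F ⊆ closure Y ∧ IsClosed F ∧
      O ∩ Y ⊆ F ∧ IsLindelof (F \ Y) := by
    intro y hy
    obtain ⟨f, hf⟩ := hhom ⟨y, hy⟩ ⟨y₀, hy₀⟩
    set G : Set Y := f ⁻¹' G₀
    have hGc : IsClosed G := hG₀c.preimage f.continuous
    have hGn : G ∈ 𝓝 (⟨y, hy⟩ : Y) := f.continuous.continuousAt.preimage_mem_nhds (hf ▸ hG₀n)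
    obtain ⟨O', hO', hO'o, hyO'⟩ := mem_nhds_iff.1 hGn
    obtain ⟨O, hO, rfl⟩ := isOpen_induced_iff.1 hO'o
    refine ⟨O, closure (range fun z : G => ((z : Y) : B)), hO, hyO',
      closure_mono (by rintro _ ⟨z, rfl⟩; exact z.1.2), isClosed_closure, ?_, ?_⟩
    · rintro z ⟨hzO, hzY⟩
      exact subset_closure ⟨⟨⟨z, hzY⟩, hO' hzO⟩, rfl⟩
    · have h1 : IsInducing fun z : G => ((z : Y) : B) :=
        IsInducing.subtypeVal.comp IsInducing.subtypeVal
      have h2 : IsInducing fun z : G => ((f z : Y) : B) :=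
        (IsInducing.subtypeVal.comp f.isInducing).comp IsInducing.subtypeVal
      have h3 : (range fun z : G => ((f z : Y) : B)) = range fun z : G₀ => ((z : Y) : B) := by
        ext b
        constructor
        · rintro ⟨z, rfl⟩
          exact ⟨⟨f z, z.2⟩, rfl⟩
        · rintro ⟨z, rfl⟩
          exact ⟨⟨f.symm z, by simp [G]⟩, by simp⟩
      rw [← hrem hGc]
      exact isLindelof_closure_range_diff_range h1 h2 (by rwa [h3])
  choose! O F hO hyO hFY hFc hOF hF using hpt
  obtain ⟨t, htc, htY, hYt⟩ := hY.elim_nhds_subcover O fun y hy => (hO y hy).mem_nhds (hyO y hy)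
  have hunion : closure Y \ Y = (closure Y \ ⋃ y ∈ t, O y) ∪ ⋃ y ∈ t, (F y \ Y) := by
    ext b
    constructor
    · rintro ⟨hb, hbY⟩
      by_cases hbO : b ∈ ⋃ y ∈ t, O y
      · right
        simp only [mem_iUnion, exists_prop] at hbO ⊢
        obtain ⟨y, hyt, hby⟩ := hbO
        refine ⟨y, hyt, ?_, hbY⟩
        exact closure_minimal (hOF y (htY y hyt)) (hFc y (htY y hyt))
          ((hO y (htY y hyt)).inter_closure ⟨hby, hb⟩)
      · exact Or.inl ⟨hb, hbO⟩
    · rintro (⟨hb, hbO⟩ | hb)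
      · exact ⟨hb, fun h => hbO (hYt h)⟩
      · simp only [mem_iUnion, exists_prop] at hb
        obtain ⟨y, hyt, hby, hbY⟩ := hb
        exact ⟨hFY y (htY y hyt) hby, hbY⟩
  rw [hunion]
  exact (isClosed_closure.isCompact.diff
      (isOpen_biUnion fun y hy => hO y (htY y hy))).isLindelof.union
    (htc.isLindelof_biUnion fun y hy => hF y (htY y hy))

end Lindelof

theorem IsMengerSpace.lindelofSpace {X : Type u} [TopologicalSpace X] (h : IsMengerSpace X) :
    LindelofSpace X := by
  rw [← isLindelof_univ_iff]
  refine isLindelof_of_countable_subcover fun {ι} U hUo hU => ?_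
  obtain ⟨𝒱, h𝒱, hcov⟩ := h (fun _ => range U) fun _ =>
    ⟨by rintro _ ⟨i, rfl⟩; exact hUo i, by rw [sUnion_range]; exact univ_subset_iff.1 hU⟩
  have hc : (⋃ n, 𝒱 n).Countable := countable_iUnion fun n => (h𝒱 n).2.countable
  have hi : ∀ V : ⋃ n, 𝒱 n, ∃ i, U i = V := fun V => iUnion_subset (fun n => (h𝒱 n).1) V.2
  choose i hi using hi
  have := hc.to_subtype
  refine ⟨range i, countable_range i, ?_⟩
  rw [← hcov]
  intro x hx
  obtain ⟨n, V, hV, hxV⟩ := mem_iUnion.1 hx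
  have hV' : V ∈ ⋃ n, 𝒱 n := mem_iUnion.2 ⟨n, hV⟩
  exact mem_biUnion (mem_range_self ⟨V, hV'⟩) (by rwa [hi ⟨V, hV'⟩])

section PSpace

variable {X : Type u} [TopologicalSpace X]

theorem IsPSpace.of_isClosed (hp : IsPSpace X) {L : Set X} (hL : IsClosed L) : IsPSpace L := by
  obtain ⟨B, _, e, ⟨_, _, he⟩, 𝒰, ho, hs⟩ := hp
  have hemb : IsEmbedding e := he.isEmbedding
  set K : Set B := closure (e '' L)
  let i : L → K := fun x => ⟨e x, subset_closure ⟨x, x.2, rfl⟩⟩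
  have hi : IsEmbedding i :=
    .codRestrict (hemb.comp .subtypeVal) K fun x : L => subset_closure ⟨x, x.2, rfl⟩
  have hd : DenseRange i := by
    rw [DenseRange, dense_iff_closure_eq, eq_univ_iff_forall]
    rintro ⟨b, hb⟩
    rw [closure_subtype]
    convert hb using 2
    ext c
    simpa [i] using fun x hx h => h ▸ subset_closure (mem_image_of_mem e hx)
  refine ⟨K, inferInstance, i, ⟨isCompact_iff_compactSpace.1 isClosed_closure.isCompact,
    inferInstance, ⟨⟨hi.isInducing, hd⟩, hi.injective⟩⟩,
    fun n => (fun U => Subtype.val ⁻¹' U) '' 𝒰 n, ?_, fun x => ⟨?_, ?_⟩⟩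
  · rintro n _ ⟨U, hU, rfl⟩
    exact (ho n U hU).preimage continuous_subtype_val
  · refine mem_iInter.2 fun n => ?_
    obtain ⟨U, ⟨hU, hxU⟩, -⟩ := mem_iInter.1 (hs x).1 n
    exact ⟨_, ⟨⟨U, hU, rfl⟩, hxU⟩, hxU⟩
  · intro z hz
    obtain ⟨y, hy⟩ : (z : B) ∈ range e := by
      refine (hs x).2 (mem_iInter.2 fun n => ?_)
      obtain ⟨_, ⟨⟨U, hU, rfl⟩, hxU⟩, hzU⟩ := mem_iInter.1 hz n
      exact ⟨U, ⟨hU, hxU⟩, hzU⟩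
    have hyL : y ∈ L := by
      rw [← hL.closure_eq, hemb.closure_eq_preimage_closure_image, mem_preimage, hy]
      exact z.2
    exact ⟨⟨y, hyL⟩, Subtype.ext hy⟩

theorem IsPSpace.isLindelof_remainder (hp : IsPSpace X) {B : Type u} [TopologicalSpace B]
    {e : X → B} (he : IsCompactification e) : IsLindelof (remainder e) := by
  obtain ⟨B', _, e', ⟨_, _, he'⟩, 𝒰, ho, hs⟩ := hp
  have := he.compact
  have := he.t2
  have h1 : IsLindelof (range e')ᶜ := by
    refine isLindelof_compl_of_feathering ho ?_ ?_
    · rintro _ ⟨x, rfl⟩ n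
      obtain ⟨U, ⟨hU, hxU⟩, -⟩ := mem_iInter.1 (hs x).1 n
      exact ⟨U, hU, hxU⟩
    · rintro _ ⟨x, rfl⟩ z hz
      refine (hs x).2 (mem_iInter.2 fun n => ?_)
      obtain ⟨U, hU, hxU, hzU⟩ := hz n
      exact ⟨U, ⟨hU, hxU⟩, hzU⟩
  have h2 := isLindelof_closure_range_diff_range he.isDenseEmbedding.isInducing he'.isInducing
    (by rwa [he'.dense.closure_eq, ← compl_eq_univ_sdiff])
  rwa [he.isDenseEmbedding.dense.closure_eq, ← compl_eq_univ_sdiff] at h2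

theorem IsPSpace.isLindelofSigmaSpace (hp : IsPSpace X) [LindelofSpace X] :
    IsLindelofSigmaSpace X :=
  ⟨X, inferInstance, id, inferInstance, hp, continuous_id, Function.surjective_id⟩

theorem IsLocallyMengerSpace.exists_isOpen_isLindelof_closure_diff_remainder
    (hM : IsLocallyMengerSpace X) {B : Type u} [TopologicalSpace B] {e : X → B}
    (he : IsCompactification e) {a : B} (ha : a ∉ remainder e) :
    ∃ W : Set B, IsOpen W ∧ a ∈ W ∧ IsLindelof (closure W \ remainder e) := by
  have := he.compact
  have := he.t2
  obtain ⟨x, rfl⟩ := not_not.1 ha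
  obtain ⟨U, M, hU, hM', hxU, hUM⟩ := hM x
  obtain ⟨O, hO, rfl⟩ := he.isDenseEmbedding.isInducing.isOpen_iff.1 hU
  obtain ⟨K, hK, hKc, hKO⟩ := exists_mem_nhds_isClosed_subset (hO.mem_nhds hxU)
  refine ⟨interior K, isOpen_interior, mem_interior_iff_mem_nhds.2 hK, ?_⟩
  have hcl : closure (interior K) ⊆ O := (closure_minimal interior_subset hKc).trans hKO
  have hML : IsLindelof M := isLindelof_iff_lindelofSpace.2 hM'.lindelofSpace
  have h1 : IsLindelof (e ⁻¹' closure (interior K)) :=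
    hML.of_isClosed_subset (isClosed_closure.preimage he.isDenseEmbedding.continuous)
      ((preimage_mono hcl).trans hUM)
  have h2 := h1.image he.isDenseEmbedding.continuous
  rwa [image_preimage_eq_inter_range, ← compl_compl (range e), ← sdiff_eq] at h2

end PSpace

theorem mainTheorem11 (X : Type u) [TopologicalSpace X] [T35Space X]
    (hM : IsLocallyMengerSpace X) (hp : IsPSpace X) (hr : HasHomogeneousRemainder X) :
    (∃ L Z : Set X, L ∪ Z = univ ∧
      IsClosed L ∧ IsLindelofSigmaSpace L ∧
      IsOpen Z ∧ LocallyCompactSpace Z) ∧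
    (IsNowhereLocallyCompact X → IsLindelofSigmaSpace X) := by
  obtain ⟨B, _, e, he, hhom⟩ := hr
  have := he.compact
  have := he.t2
  have hemb : IsEmbedding e := he.isDenseEmbedding.isEmbedding
  set L : Set X := e ⁻¹' closure (remainder e)
  have hLc : IsClosed L := isClosed_closure.preimage hemb.continuous
  have hLl : IsLindelof L := by
    rw [hemb.isLindelof_iff, image_preimage_eq_inter_range, ← compl_compl (range e), ← sdiff_eq]
    exact isLindelof_closure_diff_of_homogeneous (hp.isLindelof_remainder he) hhom
      fun a ha => hM.exists_isOpen_isLindelof_closure_diff_remainder he ha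
  have : LindelofSpace L := isLindelof_iff_lindelofSpace.1 hLl
  have hrange : (closure (remainder e))ᶜ ⊆ range e :=
    compl_subset_comm.1 (subset_closure (s := remainder e))
  have hZ : LocallyCompactSpace (Lᶜ : Set X) := by
    have h1 : IsEmbedding fun x : (Lᶜ : Set X) => e x := hemb.comp .subtypeVal
    have h2 : (range fun x : (Lᶜ : Set X) => e x) = (closure (remainder e))ᶜ := by
      ext b
      constructor
      · rintro ⟨x, rfl⟩
        exact x.2
      · intro hb
        obtain ⟨x, rfl⟩ := hrange hb
        exact ⟨⟨x, hb⟩, rfl⟩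
    exact (IsOpenEmbedding.mk h1 (h2 ▸ isClosed_closure.isOpen_compl)).locallyCompactSpace
  refine ⟨⟨L, Lᶜ, union_compl_self L, hLc, (hp.of_isClosed hLc).isLindelofSigmaSpace,
    hLc.isOpen_compl, hZ⟩, fun hn => ?_⟩
  have hL : L = univ := by
    rw [eq_univ_iff_forall]
    intro x
    by_contra hx
    obtain ⟨K, hK, hKn⟩ := exists_compact_mem_nhds (⟨x, hx⟩ : (Lᶜ : Set X))
    exact hn x ⟨Subtype.val '' K,
      hLc.isOpen_compl.isOpenEmbedding_subtypeVal.isOpenMap.image_mem_nhds hKn,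
      hK.image continuous_subtype_val⟩
  have : LindelofSpace X := isLindelof_univ_iff.1 (hL ▸ hLl)
  exact hp.isLindelofSigmaSpace
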